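/- Let $\mathcal X$ be a Polish space with its Borel $\sigma$-field, let $\mu$ be a Borel probability measure on $\mathcal X$, and let $\alpha:[0,\infty)\to[0,\infty)$ be convex and increasing (in the wide sense) with $\alpha(0)=0$; put $\alpha(\infty)=\lim_{r\to\infty}\alpha(r)$ and let $$\alpha^{\circledast}(s)=\sup_{r\ge 0}\{sr-\alpha(r)\}\in[0,\infty],\qquad s\ge 0,$$ be its monotone conjugate. For a lower semicontinuous $c:\mathcal X\times\mathcal X\to[0,\infty)$ and a Borel probability measure $\nu$, let $\mathcal T_c(\nu,\mu)=\inf_\pi\int c\,d\pi\in[0,\infty]$, where $\pi$ runs over the couplings of $\nu$ and $\mu$ (first marginal $\nu$, second marginal $\mu$), and let $H(\nu|\mu)$ be the relative entropy, $H(\nu|\mu)=\int\log\frac{d\nu}{d\mu}\,d\nu$ if $\nu\ll\mu$ and $+\infty$ otherwise. One says that $\mu$ satisfies $\alpha(\mathcal T_c)\le H$ if $\alpha(\mathcal T_c(\nu,\mu))\le H(\nu|\mu)$ for every Borel probability measure $\nu$ on $\mathcal X$. Let $\mathcal C_b$ and $\mathcal B_b$ be the sets of bounded continuous and of bounded Borel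 measurable functions $\mathcal X\to\mathbb R$. All inequalities below are in $[0,\infty]$, with $e^{\infty}=\infty$. (A) Let $c$ be lower semicontinuous. The following are equivalent: (1) $\mu$ satisfies $\alpha(\mathcal T_c)\le H$; (2) for all $u,v\in\mathcal C_b$ with $u(x)+v(y)\le c(x,y)$ for all $x,y$, $$\int e^{su}\,d\mu\le e^{-s\int v\,d\mu+\alpha^\circledast(s)}\quad\text{for all } s\ge 0;$$ (3) the same as (2) with $\mathcal B_b$ instead of $\mathcal C_b$. (B) Let $c$ be lower semicontinuous with $c(x,x)=0$ for all $x$. For $f,g\in\mathcal B_b$ put $P_cf(y)=\sup_x\{f(x)-c(x,y)\}$ and $Q_cg(x)=\inf_y\{g(y)+c(x,y)\}$. These functions are $\mu$-integrable (in particular measurable for the $\mu$-completion of the Borel $\sigma$-field), and the following are equivalent: (1) $\mu$ satisfies $\alpha(\mathcal T_c)\le H$; (2) $\int e^{sf}\,d\mu\le e^{s\int P_cf\,d\mu+\alpha^\circledast(s)}$ for all $f\in\mathcal C_b$, $s\ge0$; (3) $\int e^{sQ_cg}\,d\mu\le e^{s\int g\,d\mu+\alpha^\circledast(s)}$ for all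 $g\in\mathcal C_b$, $s\ge0$; (4) the same as (2) for all $f\in\mathcal B_b$; (5) the same as (3) for all $g\in\mathcal B_b$. (C) Let $d$ be a distance on $\mathcal X$, lower semicontinuous on $\mathcal X\times\mathcal X$ but not necessarily inducing the topology of $\mathcal X$; call $f:\mathcal X\to\mathbb R$ $1$-Lipschitz if $|f(x)-f(y)|\le d(x,y)$ for all $x,y$. The following are equivalent: (1) $\mu$ satisfies $\alpha(\mathcal T_d)\le H$; (2) for all Borel measurable $\mu$-integrable $1$-Lipschitz functions $f$, $$\int e^{sf}\,d\mu\le e^{s\int f\,d\mu+\alpha^\circledast(s)}\quad\text{for all } s\ge0;$$ (3) the same as (2) for all $1$-Lipschitz functions $f$ that are $\mu$-integrable, where $f$ need only be measurable for the $\mu$-completion of the Borel $\sigma$-field. Moreover, if (1) holds and $\alpha$ is not identically $0$, then every $1$-Lipschitz function that is measurable for the $\mu$-completion of the Borel $\sigma$-field is $\mu$-integrable. -/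

import Mathlib

open MeasureTheory Set
open scoped ENNReal NNReal

noncomputable section

namespace TransportEntropy

/-- The class of functions on `[0, ∞)` that are convex, increasing and vanish at `0`.
A function `α : ℝ → ℝ` is only ever evaluated on `[0, ∞)`. -/
structure ClassA (α : ℝ → ℝ) : Prop where
  convexOn : ConvexOn ℝ (Ici 0) α
  monotoneOn : MonotoneOn α (Ici 0)
  map_zero : α 0 = 0

/-- The value `α t ∈ [0, ∞]` for `t ∈ [0, ∞]`, with `α ∞ = lim_{r → ∞} α r = sup_{r ≥ 0} α r`. -/
def extendTop (α : ℝ → ℝ) (t : ℝ≥0∞) : ℝ≥0∞ :=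
  if t = ∞ then ⨆ r : ℝ≥0, ENNReal.ofReal (α r) else ENNReal.ofReal (α t.toReal)

/-- The monotone conjugate `α^⊛(s) = sup_{r ≥ 0} (s r - α r)`, with values in `(-∞, ∞]`. -/
def monotoneConjugate (α : ℝ → ℝ) (s : ℝ) : EReal :=
  ⨆ r : ℝ≥0, ((s * r - α r : ℝ) : EReal)

variable {X : Type*}

/-- Lower semicontinuity of `c` as a function on the product space `X × X`. -/
def LscCost [TopologicalSpace X] (c : X → X → ℝ≥0) : Prop :=
  LowerSemicontinuous fun p : X × X => c p.1 p.2

/-- `d` is a distance on `X`; it need not be related to the topology of `X`. -/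
structure IsDistance (d : X → X → ℝ≥0) : Prop where
  eq_zero_iff : ∀ x y, d x y = 0 ↔ x = y
  symm : ∀ x y, d x y = d y x
  triangle : ∀ x y z, d x z ≤ d x y + d y z

/-- `f` is `1`-Lipschitz with respect to `d`. -/
def IsOneLipschitz (d : X → X → ℝ≥0) (f : X → ℝ) : Prop :=
  ∀ x y, |f x - f y| ≤ d x y

/-- The optimal transport cost: the infimum of `∫ c dπ` over all couplings `π` of `ν` and `μ`. -/
def transportCost [MeasurableSpace X] (c : X → X → ℝ≥0) (ν μ : Measure X) : ℝ≥0∞ :=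
  ⨅ π : {π : Measure (X × X) // π.fst = ν ∧ π.snd = μ}, ∫⁻ p, (c p.1 p.2 : ℝ≥0∞) ∂π.1

/-- The transport-entropy inequality `α(T_c) ≤ H` for `μ`; the relative entropy `H(ν | μ)` is
`InformationTheory.klDiv ν μ`. -/
def TransportEntropyIneq [MeasurableSpace X] (α : ℝ → ℝ) (c : X → X → ℝ≥0) (μ : Measure X) :
    Prop :=
  ∀ ν : Measure X, IsProbabilityMeasure ν →
    extendTop α (transportCost c ν μ) ≤ InformationTheory.klDiv ν μ

/-- The bounded continuous functions on `X`. -/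
def Cb (X : Type*) [TopologicalSpace X] : Set (X → ℝ) :=
  {f | Continuous f ∧ ∃ K : ℝ, ∀ x, |f x| ≤ K}

/-- The bounded measurable functions on `X`. -/
def Bb (X : Type*) [MeasurableSpace X] : Set (X → ℝ) :=
  {f | Measurable f ∧ ∃ K : ℝ, ∀ x, |f x| ≤ K}

/-- `P_c f (y) = sup_x (f x - c x y)`. -/
def supConv (c : X → X → ℝ≥0) (f : X → ℝ) (y : X) : ℝ := ⨆ x, (f x - c x y)

/-- `Q_c g (x) = inf_y (g y + c x y)`. -/
def infConv (c : X → X → ℝ≥0) (g : X → ℝ) (x : X) : ℝ := ⨅ y, (g y + c x y)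

/-- The bound `∫ e^{s u} dμ ≤ e^{s m + α^⊛(s)}` for all `s ≥ 0`, as an inequality in `[0, ∞]`. -/
def ExpBound [MeasurableSpace X] (α : ℝ → ℝ) (μ : Measure X) (u : X → ℝ) (m : ℝ) : Prop :=
  ∀ s : ℝ, 0 ≤ s →
    ∫⁻ x, ENNReal.ofReal (Real.exp (s * u x)) ∂μ ≤
      EReal.exp (((s * m : ℝ) : EReal) + monotoneConjugate α s)

end TransportEntropy

end

/-! Parts (A) and (B) come from three Legendre-type dualities. A convex increasing `α` is the
supremum of lines `s r - C` with `s ≥ 0` and `C` a bound for the conjugate at `s`. Kantorovich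
duality gives `T_c(ν, μ) = sup (∫ u dν + ∫ v dμ)` over admissible pairs `u x + v y ≤ c x y`. The
Gibbs principle gives `log ∫ e^f dμ = sup_ν (∫ f dν - H(ν|μ))`, attained at the tilted measure. So
`α(T_c) ≤ H` for all `ν` says `s ∫ u dν - H(ν|μ) ≤ -s ∫ v dμ + C` for all `ν, s, C` and admissible
pairs, and the supremum over `ν` is the exponential bound (`TransportEntropyIneq.expBound`,
`transportEntropyIneq_of_expBound`).

The hard half of Kantorovich duality (`transportCost_le`) is proved on a compactification: embed `X`
in the Hilbert cube, extend a functional with the prescribed marginals by M. Riesz's theorem,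
represent it by a measure, and pull this back to `X`. The semicontinuous cost is reached through
increasing Lipschitz minorants.

For (B), the optimal partner of `f` is `-P_c f`, and that of `-g` is `Q_c g`. Their level sets are
projections of Borel sets, hence analytic and universally measurable, and Borel minorants equal
almost everywhere make (A) applicable. For (C), `(f, -f)` is admissible when `f` is Lipschitz, and
conversely a Borel Lipschitz function fits between `u` and `-v` up to a null set. Unbounded
functions are handled by truncation. -/

noncomputable section

namespace TransportEntropy

/-! ### Subgradients of `α` and its conjugate -/

section Conjugate

variable {α : ℝ → ℝ}

lemma ClassA.nonneg (hα : ClassA α) {t : ℝ} (ht : 0 ≤ t) : 0 ≤ α t := by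
  simpa [hα.map_zero] using hα.monotoneOn (mem_Ici.2 le_rfl) (mem_Ici.2 ht) ht

/-- A convex increasing function on `[0, ∞)` has a nonnegative subgradient at each `t > 0`. -/
lemma ClassA.exists_subgradient (hα : ClassA α) {t : ℝ} (ht : 0 < t) :
    ∃ s, 0 ≤ s ∧ ∀ r, 0 ≤ r → s * r - α r ≤ s * t - α t := by
  have hint : t ∈ interior (Ici (0 : ℝ)) := by simpa using ht
  -- The right derivative at `t` serves as subgradient: chords to the left have slope at most it,
  -- chords to the right at least it.
  have hleft : ∀ r, 0 ≤ r → r < t → slope α r t ≤ derivWithin α (Ioi t) t := fun r hr hrt =>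
    (hα.convexOn.slope_le_leftDeriv_of_mem_interior hr hint hrt).trans
      (hα.convexOn.leftDeriv_le_rightDeriv_of_mem_interior hint)
  refine ⟨derivWithin α (Ioi t) t, ?_, fun r hr => ?_⟩
  · refine le_trans ?_ (hleft 0 le_rfl ht)
    rw [slope_def_field, hα.map_zero]
    have := hα.nonneg ht.le
    simp only [sub_zero]
    positivity
  · rcases lt_trichotomy r t with h | rfl | h
    · have := hleft r hr h
      rw [slope_def_field, div_le_iff₀ (sub_pos.2 h)] at this
      linarith
    · exact le_rfl
    · have := hα.convexOn.rightDeriv_le_slope_of_mem_interior hint (mem_Ici.2 hr) h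
      rw [slope_def_field, le_div_iff₀ (sub_pos.2 h)] at this
      linarith

/-- If `α` does not vanish identically then its conjugate is finite at some `s > 0`. -/
lemma ClassA.exists_conjugate_bound (hα : ClassA α) (h : ∃ r : ℝ, 0 ≤ r ∧ α r ≠ 0) :
    ∃ s C : ℝ, 0 < s ∧ ∀ r, 0 ≤ r → s * r - α r ≤ C := by
  obtain ⟨r, hr, hαr⟩ := h
  have hr' : 0 < r := hr.lt_of_ne fun h => hαr (h ▸ hα.map_zero)
  obtain ⟨s, hs, hsub⟩ := hα.exists_subgradient hr'
  refine ⟨s, _, hs.lt_of_ne ?_, hsub⟩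
  rintro rfl
  have := hsub 0 le_rfl
  rw [hα.map_zero] at this
  exact hαr (le_antisymm (by linarith) (hα.nonneg hr))

lemma monotoneConjugate_le_coe {s C : ℝ} :
    monotoneConjugate α s ≤ (C : EReal) ↔ ∀ r, 0 ≤ r → s * r - α r ≤ C := by
  simp only [monotoneConjugate, iSup_le_iff, EReal.coe_le_coe_iff]
  exact ⟨fun h r hr => h ⟨r, hr⟩, fun h r => h r r.2⟩

lemma extendTop_mono (hα : ClassA α) : Monotone (extendTop α) := by
  intro t t' h
  by_cases ht' : t' = ∞
  · by_cases ht : t = ∞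
    · rw [ht, ht']
    · simp only [extendTop, ht, ht', if_true, if_false]
      exact le_iSup (fun r : ℝ≥0 => ENNReal.ofReal (α r)) t.toNNReal
  · have ht : t ≠ ∞ := ne_top_of_le_ne_top ht' h
    simp only [extendTop, ht, ht', if_false]
    exact ENNReal.ofReal_le_ofReal (hα.monotoneOn (mem_Ici.2 ENNReal.toReal_nonneg)
      (mem_Ici.2 ENNReal.toReal_nonneg) (ENNReal.toReal_mono ht' h))

lemma extendTop_ofReal {a : ℝ} (ha : 0 ≤ a) :
    extendTop α (ENNReal.ofReal a) = ENNReal.ofReal (α a) := by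
  simp [extendTop, ENNReal.toReal_ofReal ha]

variable {X : Type*} [MeasurableSpace X] {μ : Measure X} {u : X → ℝ} {m : ℝ}

lemma ereal_exp_coe (x : ℝ) : EReal.exp (x : EReal) = ENNReal.ofReal (Real.exp x) := by
  simp

/-- Trades the extended exponent for all real upper bounds `C` of the conjugate, so that later
arguments are real. If the conjugate is `⊤`, no such `C` exists and the original bound is trivial.
-/
lemma expBound_iff :
    ExpBound α μ u m ↔ ∀ s : ℝ, 0 ≤ s → ∀ C : ℝ, (∀ r, 0 ≤ r → s * r - α r ≤ C) →
      ∫⁻ x, ENNReal.ofReal (Real.exp (s * u x)) ∂μ ≤ ENNReal.ofReal (Real.exp (s * m + C)) := by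
  constructor
  · intro h s hs C hC
    refine (h s hs).trans ?_
    rw [← ereal_exp_coe, EReal.coe_add]
    exact EReal.exp_monotone (add_le_add le_rfl (monotoneConjugate_le_coe.2 hC))
  · intro h s hs
    have hbot : monotoneConjugate α s ≠ ⊥ := fun hb => by
      have : ((s * (0 : ℝ≥0) - α (0 : ℝ≥0) : ℝ) : EReal) ≤ monotoneConjugate α s :=
        le_iSup (fun r : ℝ≥0 => ((s * r - α r : ℝ) : EReal)) 0
      rw [hb, le_bot_iff] at this
      exact EReal.coe_ne_bot _ this
    by_cases htop : monotoneConjugate α s = ⊤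
    · rw [htop, EReal.add_top_of_ne_bot (EReal.coe_ne_bot _), EReal.exp_top]
      exact le_top
    · obtain ⟨C, hC⟩ : ∃ C : ℝ, (C : EReal) = monotoneConjugate α s :=
        ⟨_, EReal.coe_toReal htop hbot⟩
      rw [← hC, ← EReal.coe_add, ereal_exp_coe]
      exact h s hs C (monotoneConjugate_le_coe.1 hC.ge)

lemma ExpBound.mono {u' : X → ℝ} {m' : ℝ} (h : ExpBound α μ u m) (hu : ∀ᵐ x ∂μ, u' x ≤ u x)
    (hm : m ≤ m') : ExpBound α μ u' m' := by
  rw [expBound_iff] at h ⊢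
  intro s hs C hC
  refine le_trans (lintegral_mono_ae ?_) ((h s hs C hC).trans ?_)
  · filter_upwards [hu] with x hx
    gcongr
  · gcongr

end Conjugate

/-! ### Relative entropy and the Gibbs variational principle -/

section Entropy

variable {X : Type*} [MeasurableSpace X] {μ : Measure X} [IsProbabilityMeasure μ] {f : X → ℝ}

lemma Bb.integrable (hf : f ∈ Bb X) (ν : Measure X) [IsFiniteMeasure ν] : Integrable f ν := by
  obtain ⟨hm, K, hK⟩ := hf
  exact .of_bound hm.aestronglyMeasurable K (ae_of_all _ hK)

lemma Bb.integrable_exp (hf : f ∈ Bb X) (ν : Measure X) [IsFiniteMeasure ν] :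
    Integrable (fun x => Real.exp (f x)) ν := by
  obtain ⟨hm, K, hK⟩ := hf
  refine .of_bound hm.exp.aestronglyMeasurable (Real.exp K) (ae_of_all _ fun x => ?_)
  rw [Real.norm_eq_abs, Real.abs_exp, Real.exp_le_exp]
  exact (le_abs_self _).trans (hK x)

lemma Bb.const_mul (hf : f ∈ Bb X) (s : ℝ) : (fun x => s * f x) ∈ Bb X := by
  obtain ⟨hm, K, hK⟩ := hf
  refine ⟨hm.const_mul s, |s| * K, fun x => ?_⟩
  rw [abs_mul]
  exact mul_le_mul_of_nonneg_left (hK x) (abs_nonneg s)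

/-- The entropy of the tilted measure `e^f μ / ∫ e^f dμ`. -/
lemma klDiv_tilted (hf : f ∈ Bb X) :
    0 ≤ ∫ x, f x ∂(μ.tilted f) - Real.log (∫ x, Real.exp (f x) ∂μ) ∧
    InformationTheory.klDiv (μ.tilted f) μ =
      ENNReal.ofReal (∫ x, f x ∂(μ.tilted f) - Real.log (∫ x, Real.exp (f x) ∂μ)) := by
  have hexp := Bb.integrable_exp hf μ
  have : IsProbabilityMeasure (μ.tilted f) := isProbabilityMeasure_tilted hexp
  have hac := tilted_absolutelyContinuous μ f
  have hllr : llr (μ.tilted f) μ =ᵐ[μ.tilted f]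
      fun x => f x - Real.log (∫ x, Real.exp (f x) ∂μ) :=
    hac.ae_le (log_rnDeriv_tilted_left_self hexp)
  have hfi := Bb.integrable hf (μ.tilted f)
  have hint : Integrable (llr (μ.tilted f) μ) (μ.tilted f) :=
    (integrable_congr hllr).2 (hfi.sub (integrable_const _))
  have hval : ∫ x, llr (μ.tilted f) μ x ∂(μ.tilted f) =
      ∫ x, f x ∂(μ.tilted f) - Real.log (∫ x, Real.exp (f x) ∂μ) := by
    rw [integral_congr_ae hllr, integral_sub hfi (integrable_const _)]
    simp
  have h1 := InformationTheory.integral_llr_add_sub_measure_univ_nonneg hac hint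
  have h2 := InformationTheory.klDiv_of_ac_of_integrable hac hint
  simp only [probReal_univ, add_sub_cancel_right, hval] at h1 h2
  exact ⟨h1, h2⟩

/-- The Gibbs variational inequality. -/
lemma integral_le_klDiv_add_log (hf : f ∈ Bb X) (ν : Measure X) [IsProbabilityMeasure ν]
    (h : InformationTheory.klDiv ν μ ≠ ∞) :
    ∫ x, f x ∂ν ≤ (InformationTheory.klDiv ν μ).toReal + Real.log (∫ x, Real.exp (f x) ∂μ) := by
  obtain ⟨hac, hint⟩ := InformationTheory.klDiv_ne_top_iff.1 h
  have hexp := Bb.integrable_exp hf μ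
  have hfi := Bb.integrable hf ν
  have : IsProbabilityMeasure (μ.tilted f) := isProbabilityMeasure_tilted hexp
  -- The claim is nonnegativity of the entropy of `ν` relative to the tilted measure, once the
  -- logarithm of the density is expanded.
  have h1 := InformationTheory.integral_llr_add_sub_measure_univ_nonneg
    (hac.trans (absolutelyContinuous_tilted hexp)) (integrable_llr_tilted_right hac hfi hint hexp)
  rw [integral_llr_tilted_right hac hfi hexp hint] at h1
  rw [InformationTheory.toReal_klDiv hac hint]
  simp only [probReal_univ] at h1 ⊢
  linarith

end Entropy

/-! ### Lipschitz minorants of a lower semicontinuous function -/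

section Regularisation

open Filter Topology

variable {Z W : Type*} [MetricSpace Z]

/-- The `n`-Lipschitz regularisation on `Z` of the truncation at level `n` of a function on `W`,
pushed forward along `j : W → Z`. -/
def lipReg (j : W → Z) (c : W → ℝ≥0) (n : ℕ) (z : Z) : ℝ :=
  ⨅ w, (min (c w : ℝ) n + n * dist z (j w))

variable {j : W → Z} {c : W → ℝ≥0}

lemma lipReg_bddBelow (n : ℕ) (z : Z) :
    BddBelow (range fun w => (min (c w : ℝ) n + n * dist z (j w))) :=
  ⟨0, by rintro _ ⟨w, rfl⟩; positivity⟩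

lemma lipReg_le (n : ℕ) (w : W) : lipReg j c n (j w) ≤ c w :=
  (ciInf_le (lipReg_bddBelow n _) w).trans (by simp)

lemma lipReg_mono (z : Z) : Monotone fun n => lipReg j c n z := by
  intro n m h
  refine ciInf_mono (lipReg_bddBelow n z) fun w => ?_
  have : (n : ℝ) ≤ m := by exact_mod_cast h
  gcongr

variable [Nonempty W]

lemma lipReg_nonneg (n : ℕ) (z : Z) : 0 ≤ lipReg j c n z :=
  le_ciInf fun w => by positivity

lemma continuous_lipReg (n : ℕ) : Continuous (lipReg j c n) := by
  refine (LipschitzWith.of_le_add_mul (n : ℝ≥0) fun z z' => ?_).continuous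
  rw [← sub_le_iff_le_add]
  refine le_ciInf fun w => ?_
  rw [sub_le_iff_le_add]
  refine (ciInf_le (lipReg_bddBelow n z) w).trans ?_
  have := mul_le_mul_of_nonneg_left (dist_triangle z z' (j w)) (Nat.cast_nonneg (α := ℝ) n)
  simp only [NNReal.coe_natCast]
  linarith

/-- Take `b` strictly between `a` and `c w`. Competitors within `δ` of `w` have `c > b` by
semicontinuity; the others pay a penalty of at least `n * δ`. Hence `n ≥ max b (b / δ)` suffices. -/
lemma exists_lt_lipReg [TopologicalSpace W] (hj : IsInducing j) (hc : LowerSemicontinuous c) {w : W} {a : ℝ≥0}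
    (ha : a < c w) : ∃ n, (a : ℝ) < lipReg j c n (j w) := by
  obtain ⟨b, hab, hb⟩ := exists_between ha
  have hnear := hc w b hb
  rw [hj.nhds_eq_comap, (Metric.nhds_basis_ball.comap j).eventually_iff] at hnear
  obtain ⟨δ, hδ, hnear⟩ := hnear
  obtain ⟨n, hn⟩ := exists_nat_ge (max (b : ℝ) (b / δ))
  refine ⟨n, (NNReal.coe_lt_coe.2 hab).trans_le (le_ciInf fun w' => ?_)⟩
  have hn1 : (b : ℝ) ≤ n := (le_max_left _ _).trans hn
  have hn2 : (b : ℝ) ≤ n * δ := (div_le_iff₀ hδ).1 ((le_max_right _ _).trans hn)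
  by_cases h : dist (j w') (j w) < δ
  · have hb' : (b : ℝ) < c w' := NNReal.coe_lt_coe.2 (hnear h)
    have : (0 : ℝ) ≤ n * dist (j w) (j w') := by positivity
    have := le_min hb'.le hn1
    linarith
  · rw [not_lt, dist_comm] at h
    have : (n : ℝ) * δ ≤ n * dist (j w) (j w') := by gcongr
    have : (0 : ℝ) ≤ min (c w' : ℝ) n := by positivity
    linarith

end Regularisation

/-! ### Integrating split functions against a coupling -/

section Couplings

variable {X : Type*} [MeasurableSpace X] {ν μ : Measure X}

lemma integral_fst_add_snd {π : Measure (X × X)} (h1 : π.fst = ν) (h2 : π.snd = μ) {u v : X → ℝ}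
    (hu : Integrable u ν) (hv : Integrable v μ) :
    Integrable (fun p : X × X => u p.1 + v p.2) π ∧
      ∫ p, (u p.1 + v p.2) ∂π = ∫ x, u x ∂ν + ∫ y, v y ∂μ := by
  subst h1 h2
  have hu' : Integrable (fun p : X × X => u p.1) π := hu.comp_measurable measurable_fst
  have hv' : Integrable (fun p : X × X => v p.2) π := hv.comp_measurable measurable_snd
  refine ⟨hu'.add hv', ?_⟩
  rw [integral_add hu' hv', Measure.fst, Measure.snd,
    integral_map measurable_fst.aemeasurable hu.aestronglyMeasurable,
    integral_map measurable_snd.aemeasurable hv.aestronglyMeasurable]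

end Couplings

/-! ### Kantorovich duality through a compact embedding -/

section Duality

variable {X Y : Type*} [MetricSpace Y]

/-- The continuous function `(y, y') ↦ u y + v y'`. -/
def tensorSum (u v : C(Y, ℝ)) : C(Y × Y, ℝ) :=
  u.comp ContinuousMap.fst + v.comp ContinuousMap.snd

@[simp] lemma tensorSum_apply (u v : C(Y, ℝ)) (p : Y × Y) :
    tensorSum u v p = u p.1 + v p.2 := rfl

/-- The cone of pairs `(h, t)` with `t ≥ 0` and `h + t c ≥ 0` on the image of `X × X`. -/
def costCone (i : X → Y) (c : X → X → ℝ≥0) : PointedCone ℝ (C(Y × Y, ℝ) × ℝ) where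
  carrier := {p | 0 ≤ p.2 ∧ ∀ x x', 0 ≤ p.1 (i x, i x') + p.2 * c x x'}
  zero_mem' := by simp
  add_mem' := by
    rintro p q ⟨hp, hp'⟩ ⟨hq, hq'⟩
    refine ⟨add_nonneg hp hq, fun x x' => ?_⟩
    have := add_nonneg (hp' x x') (hq' x x')
    simp only [Prod.fst_add, Prod.snd_add, ContinuousMap.add_apply]
    linarith
  smul_mem' := by
    rintro ⟨r, hr⟩ p ⟨hp, hp'⟩
    refine ⟨mul_nonneg hr hp, fun x x' => ?_⟩
    have := mul_nonneg hr (hp' x x')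
    change 0 ≤ r * p.1 (i x, i x') + r * p.2 * c x x'
    linarith

variable [TopologicalSpace X] [MeasurableSpace X] [BorelSpace X]

lemma eq_map_of_forall_integral_eq [MeasurableSpace Y] [BorelSpace Y] {i : X → Y}
    (hi : Continuous i) {ν : Measure X} [IsProbabilityMeasure ν] {ρ : Measure Y}
    [IsFiniteMeasure ρ] (h : ∀ u : C(Y, ℝ), ∫ y, u y ∂ρ = ∫ x, u (i x) ∂ν) : ρ = ν.map i := by
  have := Measure.isProbabilityMeasure_map (μ := ν) hi.measurable.aemeasurable
  refine ext_of_forall_integral_eq_of_IsFiniteMeasure fun f => ?_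
  rw [integral_map hi.measurable.aemeasurable f.continuous.measurable.aestronglyMeasurable]
  exact h f.toContinuousMap

variable [PolishSpace X] [CompactSpace Y]

lemma integrable_continuousMap_comp {W Z : Type*} [TopologicalSpace W] [MeasurableSpace W]
    [OpensMeasurableSpace W] [TopologicalSpace Z] [CompactSpace Z] (h : C(Z, ℝ)) {j : W → Z}
    (hj : Continuous j) (π : Measure W) [IsFiniteMeasure π] : Integrable (fun w => h (j w)) π :=
  .of_bound (h.continuous.comp hj).measurable.aestronglyMeasurable ‖h‖
    (ae_of_all _ fun w => h.norm_coe_le_norm (j w))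

/-- The functional on `C(Y × Y) × ℝ` given by the product measure on the first component and
multiplication by `D` on the second. -/
def prodFunctional {i : X → Y} (hi : Continuous i) (ν μ : Measure X) [IsProbabilityMeasure ν]
    [IsProbabilityMeasure μ] (D : ℝ) : C(Y × Y, ℝ) × ℝ →ₗ[ℝ] ℝ where
  toFun p := ∫ q : X × X, p.1 (i q.1, i q.2) ∂(ν.prod μ) + p.2 * D
  map_add' p q := by
    have hj : Continuous fun q : X × X => (i q.1, i q.2) := by fun_prop
    simp only [Prod.fst_add, Prod.snd_add, ContinuousMap.add_apply]
    rw [integral_add (integrable_continuousMap_comp _ hj _) (integrable_continuousMap_comp _ hj _)]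
    ring
  map_smul' r p := by
    simp only [Prod.smul_fst, Prod.smul_snd, ContinuousMap.smul_apply, smul_eq_mul,
      integral_const_mul, RingHom.id_apply]
    ring

lemma prodFunctional_tensorSum {i : X → Y} (hi : Continuous i) (ν μ : Measure X)
    [IsProbabilityMeasure ν] [IsProbabilityMeasure μ] (D t : ℝ) (u v : C(Y, ℝ)) :
    prodFunctional hi ν μ D (tensorSum u v, t) =
      ∫ x, u (i x) ∂ν + ∫ x, v (i x) ∂μ + t * D := by
  change ∫ q : X × X, (u (i q.1) + v (i q.2)) ∂(ν.prod μ) + t * D = _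
  rw [(integral_fst_add_snd (u := fun x => u (i x)) (v := fun x => v (i x))
    (Measure.fst_prod (μ := ν) (ν := μ)) (Measure.snd_prod (μ := ν) (ν := μ))
    (integrable_continuousMap_comp _ hi _) (integrable_continuousMap_comp _ hi _)).2]

/-- If all admissible pairs of potentials have value at most `D`, there is a positive functional
on `C(Y × Y)` with the prescribed marginals which is at most `D` below the cost. -/
lemma exists_dual_functional [Nonempty X] {i : X → Y} (hi : Continuous i) {c : X → X → ℝ≥0}
    (ν μ : Measure X) [IsProbabilityMeasure ν] [IsProbabilityMeasure μ] {D : ℝ}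
    (hD : ∀ u v : C(Y, ℝ), (∀ x x', u (i x) + v (i x') ≤ c x x') →
      ∫ x, u (i x) ∂ν + ∫ x, v (i x) ∂μ ≤ D) :
    ∃ L : C(Y × Y, ℝ) →ₗ[ℝ] ℝ,
      (∀ h : C(Y × Y, ℝ), (∀ x x', 0 ≤ h (i x, i x')) → 0 ≤ L h) ∧
      (∀ u v : C(Y, ℝ), L (tensorSum u v) = ∫ x, u (i x) ∂ν + ∫ x, v (i x) ∂μ) ∧
      ∀ h : C(Y × Y, ℝ), (∀ x x', h (i x, i x') ≤ c x x') → L h ≤ D := by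
  let Φ : C(Y, ℝ) × C(Y, ℝ) × ℝ →ₗ[ℝ] C(Y × Y, ℝ) × ℝ :=
    { toFun := fun p => (tensorSum p.1 p.2.1, p.2.2)
      map_add' := fun p q => by ext <;> simp; ring
      map_smul' := fun r p => by ext <;> simp; ring }
  have hΦ : ∀ p, Φ p = (tensorSum p.1 p.2.1, p.2.2) := fun _ => rfl
  let f : (C(Y × Y, ℝ) × ℝ) →ₗ.[ℝ] ℝ :=
    ⟨LinearMap.range Φ, (prodFunctional hi ν μ D).domRestrict _⟩
  have hf : ∀ x : f.domain, f x = prodFunctional hi ν μ D x := fun _ => rfl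
  -- Positivity on the cone: for `t = 0` integrate against the product measure; for `t > 0` apply
  -- `hD` to the pair `-u / t`, `-v / t`. Cofinality: adding the constant `‖h‖` makes `h`
  -- nonnegative, and `-t` cancels the cost term.
  obtain ⟨g, hg, hpos⟩ := riesz_extension (costCone i c) f
    (by
      rintro ⟨_, ⟨u, v, t⟩, rfl⟩ ⟨ht, hp⟩
      rw [hf]
      simp only [hΦ, tensorSum_apply] at ht hp ⊢
      rcases ht.eq_or_lt with rfl | ht
      · simp only [prodFunctional, LinearMap.coe_mk, AddHom.coe_mk, zero_mul, add_zero,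
          tensorSum_apply] at hp ⊢
        exact integral_nonneg fun q => hp q.1 q.2
      · rw [prodFunctional_tensorSum]
        have := hD (-(t⁻¹ • u)) (-(t⁻¹ • v)) fun x x' => by
          have := hp x x'
          simp only [ContinuousMap.neg_apply, ContinuousMap.smul_apply, smul_eq_mul]
          have h2 : t⁻¹ * (u (i x) + v (i x') + t * c x x') ≥ 0 := by positivity
          rw [mul_add, inv_mul_cancel_left₀ ht.ne'] at h2
          linarith
        simp only [ContinuousMap.neg_apply, ContinuousMap.smul_apply, smul_eq_mul, integral_neg,
          integral_const_mul] at this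
        have h2 := mul_le_mul_of_nonneg_left this ht.le
        have e : ∀ a : ℝ, t * (t⁻¹ * a) = a := fun a => mul_inv_cancel_left₀ ht.ne' a
        rw [mul_add, mul_neg, mul_neg, e, e] at h2
        linarith)
    (by
      rintro ⟨h, t⟩
      refine ⟨⟨_, (ContinuousMap.const Y ‖h‖, 0, -t), rfl⟩, ?_⟩
      refine ⟨by simp [hΦ], fun x x' => ?_⟩
      have := (abs_le.1 (h.norm_coe_le_norm (i x, i x'))).1
      simp [hΦ]
      linarith)
  have hg' : ∀ u v t, g (tensorSum u v, t) = ∫ x, u (i x) ∂ν + ∫ x, v (i x) ∂μ + t * D :=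
    fun u v t => (hg ⟨_, (u, v, t), rfl⟩).trans (by
      rw [hf]; exact prodFunctional_tensorSum hi ν μ D t u v)
  refine ⟨g.comp (LinearMap.inl ℝ _ _), fun h hh => hpos _ ⟨le_rfl, by simpa using hh⟩,
    fun u v => by simp [hg'], fun h hh => ?_⟩
  have h1 : g (0, 1) = D := by
    have := hg' 0 0 1
    rwa [show tensorSum (0 : C(Y, ℝ)) 0 = 0 by ext; simp, ContinuousMap.coe_zero,
      show ∫ x, (0 : Y → ℝ) (i x) ∂ν = 0 by simp, show ∫ x, (0 : Y → ℝ) (i x) ∂μ = 0 by simp,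
      add_zero, zero_add, one_mul] at this
  -- The cost itself corresponds to `(0, 1)`, whose value is `D`, and `h ≤ c` puts `(-h, 1)` in the
  -- cone.
  have h2 := hpos (-h, 1) ⟨zero_le_one, fun x x' => by
    have := hh x x'
    simp only [ContinuousMap.neg_apply]
    linarith⟩
  have h3 : ((-h, 1) : C(Y × Y, ℝ) × ℝ) = (0, 1) - (h, 0) := by simp
  rw [h3, map_sub, h1] at h2
  simpa using h2

/-- The Riesz representation theorem on a compact space, for functionals on `C(Z)`. -/
lemma exists_measure_of_positive {Z : Type*} [TopologicalSpace Z] [T2Space Z] [CompactSpace Z]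
    [MeasurableSpace Z] [BorelSpace Z] (L : C(Z, ℝ) →ₗ[ℝ] ℝ)
    (hL : ∀ h : C(Z, ℝ), (∀ z, 0 ≤ h z) → 0 ≤ L h) :
    ∃ π : Measure Z, IsFiniteMeasure π ∧ ∀ h : C(Z, ℝ), ∫ z, h z ∂π = L h := by
  let Λ : CompactlySupportedContinuousMap Z ℝ →ₚ[ℝ] ℝ :=
    { toFun g := L g.toContinuousMap
      map_add' g g' := map_add L g.toContinuousMap g'.toContinuousMap
      map_smul' r g := map_smul L r g.toContinuousMap
      monotone' g g' hgg' := by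
        have := hL (g'.toContinuousMap - g.toContinuousMap) fun z => sub_nonneg.2 (hgg' z)
        rw [map_sub] at this
        exact sub_nonneg.1 this }
  refine ⟨RealRMK.rieszMeasure Λ, inferInstance, fun h => ?_⟩
  exact RealRMK.integral_rieszMeasure Λ ⟨h, HasCompactSupport.of_compactSpace _⟩

/-- **Kantorovich duality**, the hard inequality. -/
theorem transportCost_le {c : X → X → ℝ≥0} (hc : LscCost c) (ν μ : Measure X)
    [IsProbabilityMeasure ν] [IsProbabilityMeasure μ] {D : ℝ}
    (hD : ∀ u ∈ Cb X, ∀ v ∈ Cb X, (∀ x y, u x + v y ≤ c x y) →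
      ∫ x, u x ∂ν + ∫ y, v y ∂μ ≤ D) :
    transportCost c ν μ ≤ ENNReal.ofReal D := by
  have : Nonempty X := nonempty_of_isProbabilityMeasure ν
  let := TopologicalSpace.metrizableSpaceMetric X
  obtain ⟨i, hi⟩ := Metric.PiNatEmbed.exists_embedding_to_hilbert_cube (X := X)
  let := TopologicalSpace.metrizableSpaceMetric (ℕ → unitInterval)
  have hCb : ∀ u : C(ℕ → unitInterval, ℝ), (fun x => u (i x)) ∈ Cb X := fun u =>
    ⟨u.continuous.comp hi.continuous, ‖u‖, fun x => u.norm_coe_le_norm _⟩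
  obtain ⟨L, hpos, hmarg, hle⟩ := exists_dual_functional hi.continuous (c := c) ν μ (D := D)
    fun u v huv => hD _ (hCb u) _ (hCb v) huv
  obtain ⟨π, hfin, hπ⟩ := exists_measure_of_positive L fun h hh => hpos h fun x x' => hh _
  have hfst : π.fst = ν.map i := eq_map_of_forall_integral_eq hi.continuous fun u => by
    rw [Measure.fst, integral_map measurable_fst.aemeasurable
      u.continuous.measurable.aestronglyMeasurable]
    have := (hπ (tensorSum u 0)).trans (hmarg u 0)
    simpa using this
  have hsnd : π.snd = μ.map i := eq_map_of_forall_integral_eq hi.continuous fun u => by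
    rw [Measure.snd, integral_map measurable_snd.aemeasurable
      u.continuous.measurable.aestronglyMeasurable]
    have := (hπ (tensorSum 0 u)).trans (hmarg 0 u)
    simpa using this
  have hie : MeasurableEmbedding i := hi.continuous.measurableEmbedding hi.injective
  let j : X × X → (ℕ → unitInterval) × (ℕ → unitInterval) := Prod.map i i
  have hj : Topology.IsEmbedding j := hi.prodMap hi
  have hje : MeasurableEmbedding j := hj.continuous.measurableEmbedding hj.injective
  -- Both marginals live on `range i`, so `π` gives no mass to the points added by the
  -- compactification and can be pulled back.
  have hrange : ∀ᵐ p ∂π, p ∈ range j := by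
    have h0 : ∀ ρ : Measure X, ∀ᵐ y ∂(ρ.map i), y ∈ range i := fun ρ => by
      exact (ae_map_iff hie.measurable.aemeasurable (p := (· ∈ range i))
        hie.measurableSet_range).2 (ae_of_all _ mem_range_self)
    have h1 : ∀ᵐ p ∂π, p.1 ∈ range i :=
      ae_of_ae_map measurable_fst.aemeasurable (hfst ▸ h0 ν : ∀ᵐ y ∂π.fst, y ∈ range i)
    have h2 : ∀ᵐ p ∂π, p.2 ∈ range i :=
      ae_of_ae_map measurable_snd.aemeasurable (hsnd ▸ h0 μ : ∀ᵐ y ∂π.snd, y ∈ range i)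
    filter_upwards [h1, h2] with p hp1 hp2
    rw [range_prodMap]
    exact ⟨hp1, hp2⟩
  have hmap : (π.comap j).map j = π := by
    rw [hje.map_comap, Measure.restrict_eq_self_of_ae_mem hrange]
  have hfst' : (π.comap j).fst = ν := by
    rw [← hie.comap_map ν, ← hfst, ← hie.comap_map (π.comap j).fst]
    congr 1
    conv_rhs => rw [← hmap]
    rw [Measure.fst, Measure.fst, Measure.map_map hie.measurable measurable_fst,
      Measure.map_map measurable_fst hje.measurable]
    rfl
  have hsnd' : (π.comap j).snd = μ := by
    rw [← hie.comap_map μ, ← hsnd, ← hie.comap_map (π.comap j).snd]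
    congr 1
    conv_rhs => rw [← hmap]
    rw [Measure.snd, Measure.snd, Measure.map_map hie.measurable measurable_snd,
      Measure.map_map measurable_snd hje.measurable]
    rfl
  refine (iInf_le _ ⟨π.comap j, hfst', hsnd'⟩).trans ?_
  let C : X × X → ℝ≥0 := fun p => c p.1 p.2
  have hC : LowerSemicontinuous C := hc
  -- By monotone convergence it is enough to bound the integral of each minorant, which is
  -- continuous on the whole cube and hence controlled by `L`.
  have hsup : ∀ p : X × X, (C p : ℝ≥0∞) ≤ ⨆ n, ENNReal.ofReal (lipReg j C n (j p)) := by
    intro p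
    refine ENNReal.le_of_forall_nnreal_lt fun a ha => ?_
    obtain ⟨n, hn⟩ := exists_lt_lipReg hj.isInducing hC (ENNReal.coe_lt_coe.1 ha)
    refine le_iSup_of_le n ?_
    rw [← ENNReal.ofReal_coe_nnreal]
    exact ENNReal.ofReal_le_ofReal hn.le
  refine (lintegral_mono hsup).trans ?_
  have hmeas : ∀ n, Measurable fun p => ENNReal.ofReal (lipReg j C n (j p)) := fun n =>
    ((continuous_lipReg n).comp hj.continuous).measurable.ennreal_ofReal
  rw [lintegral_iSup hmeas fun n m hnm p => ENNReal.ofReal_le_ofReal (lipReg_mono _ hnm)]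
  refine iSup_le fun n => ?_
  let h : C((ℕ → unitInterval) × (ℕ → unitInterval), ℝ) := ⟨lipReg j C n, continuous_lipReg n⟩
  have hint : Integrable h π := integrable_continuousMap_comp h continuous_id π
  calc ∫⁻ p, ENNReal.ofReal (lipReg j C n (j p)) ∂(π.comap j)
      = ∫⁻ q, ENNReal.ofReal (h q) ∂π := by
        conv_rhs => rw [← hmap]
        rw [hje.lintegral_map]
        rfl
    _ = ENNReal.ofReal (∫ q, h q ∂π) :=
        (ofReal_integral_eq_lintegral_ofReal hint (ae_of_all _ fun q => lipReg_nonneg n q)).symm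
    _ ≤ ENNReal.ofReal D := by
        rw [hπ]
        refine ENNReal.ofReal_le_ofReal (hle h fun x x' => ?_)
        exact lipReg_le (j := j) (c := C) n (x, x')

end Duality

/-! ### Universal measurability of analytic sets -/

section Analytic

lemma isCompact_forall_le (k : ℕ → ℕ) : IsCompact {x : ℕ → ℕ | ∀ n, x n ≤ k n} := by
  have := isCompact_univ_pi fun n => (finite_Iic (k n)).isCompact
  convert this using 1
  ext x
  simp only [mem_ofPred_eq, mem_pi, mem_univ, true_imp_iff, mem_Iic]

/-- A neighbourhood of a product of initial segments contains a neighbourhood which constrains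
only finitely many coordinates. -/
lemma exists_forall_lt_le_subset {V : Set (ℕ → ℕ)} (hV : IsOpen V) (k : ℕ → ℕ)
    (h : {x : ℕ → ℕ | ∀ n, x n ≤ k n} ⊆ V) : ∃ n, {x : ℕ → ℕ | ∀ i < n, x i ≤ k i} ⊆ V := by
  let := PiNat.metricSpaceNatNat
  have hK := isCompact_forall_le k
  obtain ⟨δ, hδ, hsub⟩ := hK.exists_thickening_subset_open hV h
  obtain ⟨n, hn⟩ := exists_pow_lt_of_lt_one hδ (by norm_num : (1 / 2 : ℝ) < 1)
  -- Truncating `x` by `k` gives a point of the compact set agreeing with `x` in the first `n`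
  -- coordinates, hence closer than `δ`.
  refine ⟨n, fun x hx => hsub (Metric.mem_thickening_iff.2
    ⟨fun i => min (x i) (k i), fun i => min_le_right _ _, ?_⟩)⟩
  refine lt_of_le_of_lt (PiNat.mem_cylinder_iff_dist_le.1 fun i hi => ?_) hn
  exact (min_eq_left (hx i hi)).symm

variable {X : Type*} [TopologicalSpace X] [PolishSpace X] [MeasurableSpace X] [BorelSpace X]

/-- Analytic sets are inner regular with respect to compact sets. -/
lemma exists_isCompact_le_measure {s : Set X} (hs : AnalyticSet s) (μ : Measure X)
    [IsFiniteMeasure μ] {r : ℝ≥0∞} (hr : r < μ s) : ∃ K ⊆ s, IsCompact K ∧ r ≤ μ K := by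
  rw [AnalyticSet] at hs
  rcases hs with rfl | ⟨f, hf, rfl⟩
  · simp at hr
  -- Coordinates are bounded one at a time; continuity from below holds for arbitrary sets, so the
  -- image keeps outer measure above `r`.
  have step : ∀ (n : ℕ) (B : {B : Set (ℕ → ℕ) // r < μ (f '' B)}),
      ∃ m : ℕ, r < μ (f '' (B.1 ∩ {x | x n ≤ m})) := by
    rintro n ⟨B, hB⟩
    have hmono : Monotone fun m : ℕ => f '' (B ∩ {x | x n ≤ m}) := fun m m' h =>
      image_mono (inter_subset_inter_right _ fun x (hx : x n ≤ m) => hx.trans h)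
    have hU : f '' B = ⋃ m : ℕ, f '' (B ∩ {x | x n ≤ m}) := by
      rw [← image_iUnion, ← inter_iUnion, iUnion_eq_univ_iff.2 fun x => ⟨x n, le_refl (x n)⟩, inter_univ]
    rw [hU, hmono.directed_le.measure_iUnion, lt_iSup_iff] at hB
    exact hB
  choose m hm using step
  let B : ℕ → {B : Set (ℕ → ℕ) // r < μ (f '' B)} := fun n =>
    Nat.rec ⟨univ, by rwa [image_univ]⟩ (fun n B => ⟨_, hm n B⟩) n
  let k : ℕ → ℕ := fun n => m n (B n)
  have hB : ∀ n, (B n).1 = {x | ∀ i < n, x i ≤ k i} := by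
    intro n
    induction n with
    | zero => simp [B]
    | succ n ih =>
      change (B n).1 ∩ {x | x n ≤ k n} = _
      rw [ih]
      ext x
      exact ⟨fun h i hi => (Nat.lt_succ_iff_lt_or_eq.1 hi).elim (h.1 i) fun e => e ▸ h.2,
        fun h => ⟨fun i hi => h i (hi.trans n.lt_succ_self), h n n.lt_succ_self⟩⟩
  have hK := isCompact_forall_le k
  refine ⟨f '' {x | ∀ n, x n ≤ k n}, image_subset_range _ _, hK.image hf, ?_⟩
  -- Any open set containing the compact image already contains the image of some `B n`, so its
  -- measure exceeds `r`; outer regularity concludes.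
  refine le_of_forall_gt fun q hq => ?_
  obtain ⟨U, hKU, hU, hUq⟩ := (f '' {x | ∀ n, x n ≤ k n}).exists_isOpen_lt_of_lt q hq
  obtain ⟨n, hn⟩ := exists_forall_lt_le_subset (hU.preimage hf) k (image_subset_iff.1 hKU)
  refine lt_of_lt_of_le (B n).2 ((measure_mono (image_subset_iff.2 ?_)).trans hUq.le)
  rwa [hB]

/-- Analytic sets are universally measurable. -/
theorem analyticSet_nullMeasurableSet {s : Set X} (hs : AnalyticSet s) (μ : Measure X)
    [IsFiniteMeasure μ] : NullMeasurableSet s μ := by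
  rcases eq_or_ne (μ s) 0 with h0 | h0
  · exact .of_null h0
  obtain ⟨r, -, hr, hlim⟩ := exists_seq_strictMono_tendsto' (pos_iff_ne_zero.2 h0)
  choose K hKs hK hrK using fun n => exists_isCompact_le_measure hs μ (hr n).2
  have hm : MeasurableSet (⋃ n, K n) := .iUnion fun n => (hK n).measurableSet
  refine ⟨⋃ n, K n, hm, (ae_eq_of_subset_of_measure_ge (iUnion_subset hKs) ?_
    hm.nullMeasurableSet (measure_ne_top μ s)).symm⟩
  exact le_of_tendsto' hlim fun n => (hrK n).trans (measure_mono (subset_iUnion K n))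

end Analytic

/-! ### Bounds and measurability for `P_c` and `Q_c` -/

section Convolutions

lemma aemeasurable_of_nullMeasurableSet_Ioi {X : Type*} [MeasurableSpace X] {μ : Measure X}
    {g : X → ℝ} (h : ∀ a, NullMeasurableSet (g ⁻¹' Ioi a) μ) : AEMeasurable g μ :=
  (show NullMeasurable g μ from
    measurable_of_Ioi (δ := NullMeasurableSpace X μ) h).aemeasurable

lemma aemeasurable_of_nullMeasurableSet_Iio {X : Type*} [MeasurableSpace X] {μ : Measure X}
    {g : X → ℝ} (h : ∀ a, NullMeasurableSet (g ⁻¹' Iio a) μ) : AEMeasurable g μ :=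
  (show NullMeasurable g μ from
    measurable_of_Iio (δ := NullMeasurableSpace X μ) h).aemeasurable

variable {X : Type*} {c : X → X → ℝ≥0} {f : X → ℝ} {K : ℝ}

lemma supConv_bddAbove (hf : ∀ x, |f x| ≤ K) (y : X) : BddAbove (range fun x => f x - c x y) :=
  ⟨K, by rintro _ ⟨x, rfl⟩; have := (abs_le.1 (hf x)).2; have := (c x y).2; simp; linarith⟩

lemma infConv_bddBelow (hf : ∀ x, |f x| ≤ K) (x : X) : BddBelow (range fun y => f y + c x y) :=
  ⟨-K, by rintro _ ⟨y, rfl⟩; have := (abs_le.1 (hf y)).1; have := (c x y).2; simp; linarith⟩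

lemma add_neg_supConv_le (hf : ∀ x, |f x| ≤ K) (x y : X) : f x + -supConv c f y ≤ c x y := by
  have := le_ciSup (supConv_bddAbove (c := c) hf y) x
  simp only [supConv] at this ⊢
  linarith

lemma infConv_add_neg_le (hf : ∀ x, |f x| ≤ K) (x y : X) : infConv c f x + -f y ≤ c x y := by
  have := ciInf_le (infConv_bddBelow (c := c) hf x) y
  simp only [infConv] at this ⊢
  linarith

/-- The vanishing diagonal gives `f ≤ P_c f`, and `c ≥ 0` gives the upper bound. -/
lemma abs_supConv_le (hc : ∀ x, c x x = 0) (hf : ∀ x, |f x| ≤ K) (y : X) :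
    |supConv c f y| ≤ K := by
  have : Nonempty X := ⟨y⟩
  have h := add_neg_supConv_le (c := c) hf y y
  have hy := abs_le.1 (hf y)
  rw [hc] at h
  refine abs_le.2 ⟨by simp at h; linarith, ciSup_le fun x => ?_⟩
  have := (abs_le.1 (hf x)).2
  have := (c x y).2
  simp
  linarith

lemma abs_infConv_le (hc : ∀ x, c x x = 0) (hf : ∀ x, |f x| ≤ K) (x : X) :
    |infConv c f x| ≤ K := by
  have : Nonempty X := ⟨x⟩
  have h := infConv_add_neg_le (c := c) hf x x
  have hx := abs_le.1 (hf x)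
  rw [hc] at h
  refine abs_le.2 ⟨le_ciInf fun y => ?_, by simp at h; linarith⟩
  have := (abs_le.1 (hf y)).1
  have := (c x y).2
  simp
  linarith

variable [TopologicalSpace X] [PolishSpace X] [MeasurableSpace X] [BorelSpace X]

lemma LscCost.measurable (hc : LscCost c) : Measurable fun p : X × X => (c p.1 p.2 : ℝ) :=
  (LowerSemicontinuous.measurable hc).coe_nnreal_real

lemma aemeasurable_supConv (hc : LscCost c) (hm : Measurable f) (hf : ∀ x, |f x| ≤ K)
    (μ : Measure X) [IsFiniteMeasure μ] : AEMeasurable (supConv c f) μ := by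
  refine aemeasurable_of_nullMeasurableSet_Ioi fun a => ?_
  -- The supremum exceeds `a` exactly when some `x` does, so this level set is the projection of a
  -- Borel set.
  have hset : supConv c f ⁻¹' Ioi a = Prod.snd '' {p : X × X | a < f p.1 - c p.1 p.2} := by
    ext y
    have : Nonempty X := ⟨y⟩
    simp [supConv, lt_ciSup_iff (supConv_bddAbove (c := c) hf y)]
  rw [hset]
  exact analyticSet_nullMeasurableSet ((measurableSet_lt measurable_const
        ((hm.comp measurable_fst).sub hc.measurable)).analyticSet.image_of_continuous
          continuous_snd) μ

lemma aemeasurable_infConv (hc : LscCost c) (hm : Measurable f) (hf : ∀ x, |f x| ≤ K)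
    (μ : Measure X) [IsFiniteMeasure μ] : AEMeasurable (infConv c f) μ := by
  refine aemeasurable_of_nullMeasurableSet_Iio fun a => ?_
  have hset : infConv c f ⁻¹' Iio a = Prod.fst '' {p : X × X | f p.2 + c p.1 p.2 < a} := by
    ext x
    have : Nonempty X := ⟨x⟩
    simp [infConv, ciInf_lt_iff (infConv_bddBelow (c := c) hf x)]
  rw [hset]
  exact analyticSet_nullMeasurableSet ((measurableSet_lt
        ((hm.comp measurable_snd).add hc.measurable) measurable_const).analyticSet.image_of_continuous
          continuous_fst) μ

end Convolutions

/-! ### Equivalence of the transport inequality and the exponential bounds -/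

section Dual

variable {X : Type*} [MeasurableSpace X] {μ : Measure X} {α : ℝ → ℝ} {c : X → X → ℝ≥0}
  {u v : X → ℝ}

lemma ofReal_integral_le_lintegral {Z : Type*} [MeasurableSpace Z] {π : Measure Z} {g : Z → ℝ}
    (hg : Integrable g π) : ENNReal.ofReal (∫ z, g z ∂π) ≤ ∫⁻ z, ENNReal.ofReal (g z) ∂π := by
  refine ENNReal.ofReal_le_of_le_toReal ?_
  rw [integral_eq_lintegral_pos_part_sub_lintegral_neg_part hg]
  exact sub_le_self _ ENNReal.toReal_nonneg

/-- **Kantorovich duality**, the easy inequality. -/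
lemma le_transportCost {ν : Measure X} (hu : Integrable u ν) (hv : Integrable v μ)
    (huv : ∀ x y, u x + v y ≤ c x y) :
    ENNReal.ofReal (∫ x, u x ∂ν + ∫ y, v y ∂μ) ≤ transportCost c ν μ := by
  refine le_iInf fun ⟨π, h1, h2⟩ => ?_
  obtain ⟨hint, heq⟩ := integral_fst_add_snd h1 h2 hu hv
  rw [← heq]
  refine (ofReal_integral_le_lintegral hint).trans (lintegral_mono fun p => ?_)
  rw [← ENNReal.ofReal_coe_nnreal]
  exact ENNReal.ofReal_le_ofReal (huv _ _)

variable [IsProbabilityMeasure μ]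

lemma lintegral_exp_eq {f : X → ℝ} (hf : f ∈ Bb X) :
    ∫⁻ x, ENNReal.ofReal (Real.exp (f x)) ∂μ = ENNReal.ofReal (∫ x, Real.exp (f x) ∂μ) :=
  (ofReal_integral_eq_lintegral_ofReal (Bb.integrable_exp hf μ)
    (ae_of_all _ fun _ => (Real.exp_pos _).le)).symm

/-- The inequality is tested on the measure tilted by `s u`, where the Gibbs inequality is an
equality. -/
lemma TransportEntropyIneq.expBound (hα : ClassA α) (h : TransportEntropyIneq α c μ)
    (hu : u ∈ Bb X) (hv : v ∈ Bb X) (huv : ∀ x y, u x + v y ≤ c x y) :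
    ExpBound α μ u (-∫ y, v y ∂μ) := by
  rw [expBound_iff]
  intro s hs C hC
  have hf := Bb.const_mul hu s
  have hexp := Bb.integrable_exp hf μ
  have hprob : IsProbabilityMeasure (μ.tilted fun x => s * u x) := isProbabilityMeasure_tilted hexp
  obtain ⟨hk, hkl⟩ := klDiv_tilted (μ := μ) hf
  set ν := μ.tilted fun x => s * u x
  have hT := (extendTop_mono hα (le_transportCost (Bb.integrable hu ν) (Bb.integrable hv μ)
    huv)).trans (h ν hprob)
  rw [hkl] at hT
  rw [integral_const_mul] at hT hk
  set a := ∫ x, u x ∂ν + ∫ y, v y ∂μ with ha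
  have hlog : Real.log (∫ x, Real.exp (s * u x) ∂μ) ≤ s * -∫ y, v y ∂μ + C := by
    -- For `a < 0` the transport inequality carries no information, but then `s ∫ u dν ≤ -s ∫ v dμ`,
    -- the entropy is nonnegative, and `C ≥ 0` by taking `r = 0`.
    rcases le_or_gt 0 a with h0 | h0
    · rw [extendTop_ofReal h0, ENNReal.ofReal_le_ofReal_iff hk] at hT
      have := hC a h0
      rw [ha, mul_add] at this
      linarith
    · have h1 := mul_nonpos_of_nonneg_of_nonpos hs h0.le
      have h2 := hC 0 le_rfl
      rw [hα.map_zero] at h2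
      rw [ha, mul_add] at h1
      linarith
  rw [lintegral_exp_eq hf]
  refine ENNReal.ofReal_le_ofReal ?_
  rwa [← Real.log_le_iff_le_exp (integral_exp_pos hexp)]

variable [TopologicalSpace X] [BorelSpace X]

lemma Cb_subset_Bb : Cb X ⊆ Bb X := fun _ hf => ⟨hf.1.measurable, hf.2⟩

variable [PolishSpace X]

/-- Gibbs and the bound give each admissible pair value at most `(H + C) / s`, and duality passes
this to the cost `T`. A subgradient `s` of `α` at `T` allows `C = s T - α T`, which turns the
estimate into `α T ≤ H`. -/
lemma transportEntropyIneq_of_expBound (hα : ClassA α) (hc : LscCost c)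
    (h : ∀ u ∈ Cb X, ∀ v ∈ Cb X, (∀ x y, u x + v y ≤ c x y) →
      ExpBound α μ u (-∫ y, v y ∂μ)) : TransportEntropyIneq α c μ := by
  intro ν hν
  by_cases hkl : InformationTheory.klDiv ν μ = ∞
  · rw [hkl]
    exact le_top
  set k := (InformationTheory.klDiv ν μ).toReal with hk
  have hk' : InformationTheory.klDiv ν μ = ENNReal.ofReal k := (ENNReal.ofReal_toReal hkl).symm
  have key : ∀ s C : ℝ, 0 < s → (∀ r, 0 ≤ r → s * r - α r ≤ C) →
      transportCost c ν μ ≤ ENNReal.ofReal ((k + C) / s) := by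
    intro s C hs hC
    refine transportCost_le hc ν μ fun u hu v hv huv => ?_
    have hf := Bb.const_mul (Cb_subset_Bb hu) s
    have h1 := expBound_iff.1 (h u hu v hv huv) s hs.le C hC
    rw [lintegral_exp_eq hf, ENNReal.ofReal_le_ofReal_iff (Real.exp_pos _).le,
      ← Real.log_le_iff_le_exp (integral_exp_pos (Bb.integrable_exp hf μ))] at h1
    have h2 := integral_le_klDiv_add_log (μ := μ) hf ν hkl
    rw [integral_const_mul] at h2
    rw [le_div_iff₀ hs]
    linarith
  by_cases hne : ∃ r : ℝ, 0 ≤ r ∧ α r ≠ 0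
  · obtain ⟨s, C, hs, hC⟩ := hα.exists_conjugate_bound hne
    -- A single `s > 0` with finite conjugate already forces a finite cost.
    have htop : transportCost c ν μ ≠ ∞ :=
      ne_top_of_le_ne_top ENNReal.ofReal_ne_top (key s C hs hC)
    rw [hk', extendTop, if_neg htop]
    refine ENNReal.ofReal_le_ofReal ?_
    have hk0 : 0 ≤ k := ENNReal.toReal_nonneg
    rcases ENNReal.toReal_nonneg.eq_or_lt with ht | ht
    · rwa [← ht, hα.map_zero]
    · obtain ⟨s, hs, hsub⟩ := hα.exists_subgradient ht
      rcases hs.eq_or_lt with rfl | hs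
      · have := hsub 0 le_rfl
        rw [hα.map_zero] at this
        linarith
      · have h1 := ENNReal.toReal_mono ENNReal.ofReal_ne_top (key s _ hs hsub)
        rw [ENNReal.toReal_ofReal'] at h1
        rcases le_max_iff.1 h1 with h1 | h1
        · rw [le_div_iff₀ hs] at h1
          linarith
        · linarith
  · push Not at hne
    refine le_of_eq_of_le ?_ zero_le
    unfold extendTop
    split_ifs
    · simp [fun r : ℝ≥0 => hne r r.2]
    · simp [hne _ ENNReal.toReal_nonneg]

end Dual

/-! ### From Borel functions to functions measurable for the completion -/

section Completion

variable {X : Type*} [MeasurableSpace X] {μ : Measure X} {α : ℝ → ℝ} {c : X → X → ℝ≥0}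
  {u v : X → ℝ} {K : ℝ}

/-- A bounded function measurable for the completion has a Borel minorant that coincides with it
almost everywhere. -/
lemma exists_Bb_le_ae_eq (hu : AEMeasurable u μ) (hK : ∀ x, |u x| ≤ K) :
    ∃ u' ∈ Bb X, (∀ x, u' x ≤ u x) ∧ u' =ᵐ[μ] u := by
  classical
  let N := toMeasurable μ {x | ¬ u x = hu.mk u x}
  have hN : MeasurableSet N := measurableSet_toMeasurable _ _
  have hN0 : μ N = 0 := by
    rw [measure_toMeasurable]
    exact hu.ae_eq_mk
  have heq : ∀ x ∉ N, hu.mk u x = u x := fun x hx => by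
    by_contra hne
    exact hx (subset_toMeasurable _ _ fun h => hne h.symm)
  -- On a measurable null set covering all disagreement with the Borel version, the value `-K` is
  -- safely below `u`.
  refine ⟨N.piecewise (fun _ => -K) (hu.mk u),
    ⟨measurable_const.piecewise hN hu.measurable_mk, K, fun x => ?_⟩, fun x => ?_, ?_⟩
  · by_cases hx : x ∈ N
    · rw [piecewise_eq_of_mem _ _ _ hx, abs_neg]
      exact (abs_of_nonneg ((abs_nonneg _).trans (hK x))).le
    · rw [piecewise_eq_of_notMem _ _ _ hx, heq x hx]
      exact hK x
  · by_cases hx : x ∈ N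
    · rw [piecewise_eq_of_mem _ _ _ hx]
      exact (abs_le.1 (hK x)).1
    · rw [piecewise_eq_of_notMem _ _ _ hx, heq x hx]
  · filter_upwards [measure_eq_zero_iff_ae_notMem.1 hN0] with x hx
    rw [piecewise_eq_of_notMem _ _ _ hx, heq x hx]

/-- Passing to Borel minorants preserves admissibility and changes no integral. -/
lemma TransportEntropyIneq.expBound_of_aemeasurable [IsProbabilityMeasure μ] (hα : ClassA α)
    (h : TransportEntropyIneq α c μ) (hu : AEMeasurable u μ) (huK : ∀ x, |u x| ≤ K)
    (hv : AEMeasurable v μ) (hvK : ∀ x, |v x| ≤ K) (huv : ∀ x y, u x + v y ≤ c x y) :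
    ExpBound α μ u (-∫ y, v y ∂μ) := by
  obtain ⟨u', hu', hle, hae⟩ := exists_Bb_le_ae_eq hu huK
  obtain ⟨v', hv', hle', hae'⟩ := exists_Bb_le_ae_eq hv hvK
  have := h.expBound hα hu' hv' fun x y => (add_le_add (hle x) (hle' y)).trans (huv x y)
  exact this.mono (hae.mono fun x hx => hx.ge) (by rw [integral_congr_ae hae'])

end Completion

/-! ### Exponential bounds and integrability for Lipschitz functions -/

section Lipschitz

open Filter Topology

lemma IsOneLipschitz.truncate {X : Type*} {d : X → X → ℝ≥0} {f : X → ℝ}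
    (hL : IsOneLipschitz d f) (a b : ℝ) :
    IsOneLipschitz d fun x => max (min (f x) a) b := fun x y =>
  (abs_max_sub_max_le_abs _ _ _).trans ((abs_min_sub_min_le_max _ _ _ _).trans
    (by simpa using hL x y))

variable {X : Type*} [MeasurableSpace X] {μ : Measure X} [IsProbabilityMeasure μ] {α : ℝ → ℝ}
  {d : X → X → ℝ≥0} {f : X → ℝ}

lemma TransportEntropyIneq.expBound_of_bounded_lipschitz (hα : ClassA α)
    (h : TransportEntropyIneq α d μ) (hf : AEMeasurable f μ) (hL : IsOneLipschitz d f) {K : ℝ}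
    (hK : ∀ x, |f x| ≤ K) : ExpBound α μ f (∫ x, f x ∂μ) := by
  have := h.expBound_of_aemeasurable hα hf hK hf.neg (fun x => (abs_neg (f x)).trans_le (hK x))
    fun x y => by
      have := (le_abs_self _).trans (hL x y)
      simp only [Pi.neg_apply]
      linarith
  simpa [integral_neg] using this

/-- Truncations remain Lipschitz; dominated convergence handles the mean and Fatou's lemma the
exponential integral. -/
lemma TransportEntropyIneq.expBound_of_lipschitz (hα : ClassA α)
    (h : TransportEntropyIneq α d μ) (hf : Integrable f μ) (hL : IsOneLipschitz d f) :
    ExpBound α μ f (∫ x, f x ∂μ) := by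
  rw [expBound_iff]
  intro s hs C hC
  let g : ℕ → X → ℝ := fun n x => max (min (f x) n) (-n)
  have hgm : ∀ n, AEMeasurable (g n) μ := fun n =>
    (hf.aemeasurable.min aemeasurable_const).max aemeasurable_const
  have hgn : ∀ n x, |g n x| ≤ n := fun n x => by
    have : (0 : ℝ) ≤ n := n.cast_nonneg
    exact abs_le.2 ⟨le_max_right _ _, max_le (min_le_right _ _) (by linarith)⟩
  have hgf : ∀ n x, |g n x| ≤ |f x| := fun n x => by
    have : (0 : ℝ) ≤ n := n.cast_nonneg
    refine abs_le.2 ⟨(le_max_iff.2 (Or.inl (le_min (neg_abs_le _) ?_))),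
      max_le ((min_le_left _ _).trans (le_abs_self _)) ?_⟩ <;>
    linarith [abs_nonneg (f x)]
  have hglim : ∀ x, ∀ᶠ n in atTop, g n x = f x := fun x => by
    obtain ⟨N, hN⟩ := exists_nat_ge |f x|
    filter_upwards [eventually_ge_atTop N] with n hn
    have h1 := abs_le.1 (hN.trans (Nat.cast_le.2 hn))
    simp [g, min_eq_left h1.2, max_eq_left h1.1]
  have hint : Tendsto (fun n => ∫ x, g n x ∂μ) atTop (𝓝 (∫ x, f x ∂μ)) :=
    tendsto_integral_of_dominated_convergence (fun x => |f x|)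
      (fun n => (hgm n).aestronglyMeasurable) hf.abs (fun n => ae_of_all _ (hgf n))
      (ae_of_all _ fun x => tendsto_nhds_of_eventually_eq (hglim x))
  have hrhs : Tendsto (fun n => ENNReal.ofReal (Real.exp (s * ∫ x, g n x ∂μ + C))) atTop
      (𝓝 (ENNReal.ofReal (Real.exp (s * ∫ x, f x ∂μ + C)))) :=
    ENNReal.tendsto_ofReal ((Real.continuous_exp.tendsto _).comp
      ((hint.const_mul s).add_const C))
  calc ∫⁻ x, ENNReal.ofReal (Real.exp (s * f x)) ∂μ
      = ∫⁻ x, liminf (fun n => ENNReal.ofReal (Real.exp (s * g n x))) atTop ∂μ := by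
        refine lintegral_congr fun x => (Tendsto.liminf_eq ?_).symm
        exact tendsto_nhds_of_eventually_eq ((hglim x).mono fun n hn => by rw [hn])
    _ ≤ liminf (fun n => ∫⁻ x, ENNReal.ofReal (Real.exp (s * g n x)) ∂μ) atTop :=
        lintegral_liminf_le' fun n => ((hgm n).const_mul s).exp.ennreal_ofReal
    _ ≤ liminf (fun n => ENNReal.ofReal (Real.exp (s * ∫ x, g n x ∂μ + C))) atTop :=
        liminf_le_liminf (Eventually.of_forall fun n => expBound_iff.1
          (h.expBound_of_bounded_lipschitz hα (hgm n) (hL.truncate _ _) (hgn n)) s hs C hC)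
    _ = _ := hrhs.liminf_eq

/-- Apply the bound to `-min |f| n`. Since `|f| ≤ M` with probability above `1/2`, the exponential
integral is at least `e^{-sM} / 2`, which bounds `∫ min |f| n` uniformly in `n`. -/
lemma TransportEntropyIneq.integrable_of_lipschitz (hα : ClassA α)
    (h : TransportEntropyIneq α d μ) (hne : ∃ r : ℝ, 0 ≤ r ∧ α r ≠ 0) (hf : AEMeasurable f μ)
    (hL : IsOneLipschitz d f) : Integrable f μ := by
  obtain ⟨s, C, hs, hC⟩ := hα.exists_conjugate_bound hne
  have hfabs : AEMeasurable (fun x => |f x|) μ := hf.abs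
  obtain ⟨M, hM⟩ : ∃ M : ℕ, (1 / 2 : ℝ≥0∞) < μ {x | |f x| ≤ M} := by
    have hmono : Monotone fun M : ℕ => {x | |f x| ≤ M} := fun M M' hMM' x (hx : |f x| ≤ M) =>
      hx.trans (Nat.cast_le.2 hMM')
    have hU : ⋃ M : ℕ, {x | |f x| ≤ M} = univ :=
      iUnion_eq_univ_iff.2 fun x => exists_nat_ge |f x|
    have := hmono.directed_le.measure_iUnion (μ := μ)
    rw [hU, measure_univ] at this
    rw [← lt_iSup_iff, ← this]
    simp
  let g : ℕ → X → ℝ := fun n x => min |f x| n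
  have hg0 : ∀ n x, 0 ≤ g n x := fun n x => le_min (abs_nonneg _) n.cast_nonneg
  have hgm : ∀ n, AEMeasurable (g n) μ := fun n => hfabs.min aemeasurable_const
  have hgn : ∀ n x, |-g n x| ≤ n := fun n x => by
    rw [abs_neg, abs_of_nonneg (hg0 n x)]
    exact min_le_right _ _
  have hgL : ∀ n, IsOneLipschitz d fun x => -g n x := fun n x y => by
    have h1 := abs_min_sub_min_le_max (|f y|) n (|f x|) n
    have h2 := abs_abs_sub_abs_le (f y) (f x)
    rw [abs_sub_comm (f y)] at h2
    have h3 : |(|f y| - |f x|)| ≤ d x y := h2.trans (hL x y)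
    rw [show -g n x - -g n y = g n y - g n x by ring]
    simpa [h3] using h1.trans (max_le h3 (by simp))
  have hgi : ∀ n, Integrable (g n) μ := fun n =>
    .of_bound (hgm n).aestronglyMeasurable n (ae_of_all _ fun x => by simpa using hgn n x)
  have hbound : ∀ n, ∫ x, g n x ∂μ ≤ (C + s * M + Real.log 2) / s := by
    intro n
    have h1 := expBound_iff.1 (h.expBound_of_bounded_lipschitz hα (hgm n).neg (hgL n) (hgn n))
      s hs.le C hC
    have h2 := mul_meas_ge_le_lintegral₀ (μ := μ)
      (((hgm n).neg.const_mul s).exp.ennreal_ofReal) (ENNReal.ofReal (Real.exp (-(s * M))))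
    have h3 : (1 / 2 : ℝ≥0∞) ≤ μ {x | ENNReal.ofReal (Real.exp (-(s * M))) ≤
        ENNReal.ofReal (Real.exp (s * (-g n) x))} := by
      refine hM.le.trans (measure_mono fun x (hx : |f x| ≤ M) => ?_)
      refine ENNReal.ofReal_le_ofReal (Real.exp_le_exp.2 ?_)
      have := mul_le_mul_of_nonneg_left ((min_le_left _ _).trans hx : g n x ≤ M) hs.le
      simp only [Pi.neg_apply]
      linarith
    have h4 := ((mul_le_mul_right h3 _).trans h2).trans h1
    rw [show (1 / 2 : ℝ≥0∞) = ENNReal.ofReal (Real.exp (-Real.log 2)) by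
      rw [Real.exp_neg, Real.exp_log two_pos, ENNReal.ofReal_inv_of_pos two_pos]; simp,
      ← ENNReal.ofReal_mul (Real.exp_pos _).le, ← Real.exp_add,
      ENNReal.ofReal_le_ofReal_iff (Real.exp_pos _).le, Real.exp_le_exp] at h4
    simp only [Pi.neg_apply, integral_neg] at h4
    rw [le_div_iff₀ hs]
    linarith
  refine ⟨hf.aestronglyMeasurable, ?_⟩
  rw [hasFiniteIntegral_iff_norm]
  have hsup : ∀ x, ENNReal.ofReal ‖f x‖ ≤ ⨆ n, ENNReal.ofReal (g n x) := fun x => by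
    obtain ⟨n, hn⟩ := exists_nat_ge |f x|
    refine le_iSup_of_le n ?_
    simp [g, min_eq_left hn]
  refine lt_of_le_of_lt (lintegral_mono hsup)
    (lt_of_le_of_lt ?_ (ENNReal.ofReal_lt_top (r := (C + s * M + Real.log 2) / s)))
  rw [lintegral_iSup' (fun n => (hgm n).ennreal_ofReal) (ae_of_all _ fun x n m hnm =>
    ENNReal.ofReal_le_ofReal (min_le_min le_rfl (Nat.cast_le.2 hnm)))]
  refine iSup_le fun n => ?_
  rw [← ofReal_integral_eq_lintegral_ofReal (hgi n) (ae_of_all _ (hg0 n))]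
  exact ENNReal.ofReal_le_ofReal (hbound n)

end Lipschitz

/-! ### Borel Lipschitz functions between admissible potentials -/

section MetricCost

variable {X : Type*} [TopologicalSpace X] {d : X → X → ℝ≥0} {u : X → ℝ}

/-- A closed sublevel set of a lower semicontinuous function is projected along the compact factor
`K`, and such projections are closed maps. -/
lemma isClosed_exists_mem_le_sub (hd : LscCost d) (hu : Continuous u) {K : Set X}
    (hK : IsCompact K) (b : ℝ) : IsClosed {y | ∃ x ∈ K, b ≤ u x - d x y} := by
  have : CompactSpace K := isCompact_iff_compactSpace.1 hK
  have hlsc : LowerSemicontinuous fun p : X × X => (d p.1 p.2 : ℝ) :=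
    NNReal.continuous_coe.comp_lowerSemicontinuous hd NNReal.coe_mono
  have hlsc' : LowerSemicontinuous fun q : K × X => (d q.1 q.2 : ℝ) + -u q.1 :=
    (hlsc.comp (by fun_prop : Continuous fun q : K × X => ((q.1 : X), q.2))).add
      (by fun_prop : Continuous fun q : K × X => -u q.1).lowerSemicontinuous
  have hcl : IsClosed {q : K × X | (d q.1 q.2 : ℝ) + -u q.1 ≤ -b} := hlsc'.isClosed_preimage (-b)
  convert isClosedMap_snd_of_compactSpace _ hcl using 1
  ext y
  simp only [mem_ofPred_eq, mem_image, Prod.exists, Subtype.exists]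
  constructor
  · rintro ⟨x, hx, h⟩
    exact ⟨x, hx, y, by linarith, rfl⟩
  · rintro ⟨x, hx, y', h, rfl⟩
    exact ⟨x, hx, by linarith⟩

variable [MeasurableSpace X] [BorelSpace X]

/-- The supremal convolution over a `σ`-compact set is Borel. -/
lemma measurable_iSup_sub (hd : LscCost d) (hu : Continuous u) {K : ℕ → Set X}
    (hK : ∀ n, IsCompact (K n)) (hne : (⋃ n, K n).Nonempty)
    (hb : ∀ y, BddAbove (range fun x : ⋃ n, K n => u x - d x y)) :
    Measurable fun y => ⨆ x : ⋃ n, K n, (u x - d x y) := by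
  have : Nonempty (⋃ n, K n) := hne.to_subtype
  refine measurable_of_Ioi fun a => ?_
  -- Closedness needs a non-strict inequality, hence the margin `1 / (m + 1)`.
  have : (fun y => ⨆ x : ⋃ n, K n, (u x - d x y)) ⁻¹' Ioi a =
      ⋃ (n : ℕ) (m : ℕ), {y | ∃ x ∈ K n, a + 1 / ((m : ℝ) + 1) ≤ u x - d x y} := by
    ext y
    simp only [mem_preimage, mem_Ioi, lt_ciSup_iff (hb y), mem_iUnion, mem_ofPred_eq]
    constructor
    · rintro ⟨⟨x, hx⟩, h⟩
      obtain ⟨n, hn⟩ := mem_iUnion.1 hx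
      obtain ⟨m, hm⟩ := exists_nat_one_div_lt (sub_pos.2 h)
      exact ⟨n, m, x, hn, by simp only at hm; linarith⟩
    · rintro ⟨n, m, x, hx, h⟩
      have : 0 < 1 / ((m : ℝ) + 1) := by positivity
      exact ⟨⟨x, mem_iUnion.2 ⟨n, hx⟩⟩, by simp only; linarith⟩
  rw [this]
  exact .iUnion fun n => .iUnion fun m => (isClosed_exists_mem_le_sub hd hu (hK n) _).measurableSet

variable [PolishSpace X]

lemma exists_isCompact_ae_mem_iUnion (μ : Measure X) [IsFiniteMeasure μ] :
    ∃ K : ℕ → Set X, (∀ n, IsCompact (K n)) ∧ ∀ᵐ x ∂μ, x ∈ ⋃ n, K n := by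
  have ht := isTightMeasureSet_iff_exists_isCompact_measure_compl_le.1
    (isTightMeasureSet_singleton (μ := μ))
  choose K hK hKμ using fun n : ℕ => ht ((n : ℝ≥0∞) + 1)⁻¹ (by simp)
  refine ⟨K, hK, ?_⟩
  rw [ae_iff]
  refine le_antisymm (le_of_forall_gt fun ε hε => ?_) zero_le
  obtain ⟨n, hn⟩ := ENNReal.exists_inv_nat_lt hε.ne'
  refine lt_of_le_of_lt ?_ hn
  refine (measure_mono ?_).trans ((hKμ n μ rfl).trans (ENNReal.inv_le_inv.2 le_self_add))
  exact fun x hx hxK => hx (mem_iUnion.2 ⟨n, hxK⟩)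

/-- Between `u` and `-v` there is, up to a null set, a bounded Borel `1`-Lipschitz function. -/
lemma exists_lipschitz_between (μ : Measure X) [IsProbabilityMeasure μ] (hd : LscCost d)
    (hdist : IsDistance d) {v : X → ℝ} (hu : u ∈ Cb X) (hv : v ∈ Cb X)
    (huv : ∀ x y, u x + v y ≤ d x y) :
    ∃ f ∈ Bb X, IsOneLipschitz d f ∧ (∀ᵐ x ∂μ, u x ≤ f x) ∧ ∀ y, f y ≤ -v y := by
  obtain ⟨K, hK, hKμ⟩ := exists_isCompact_ae_mem_iUnion μ
  obtain ⟨huc, A, hA⟩ := hu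
  obtain ⟨hvc, B, hB⟩ := hv
  have hle : ∀ x y, u x - d x y ≤ -v y := fun x y => by linarith [huv x y]
  have hb : ∀ y, BddAbove (range fun x : ⋃ n, K n => u x - d x y) := fun y =>
    ⟨-v y, by rintro _ ⟨x, rfl⟩; exact hle x y⟩
  have hne : (⋃ n, K n).Nonempty := hKμ.exists
  have : Nonempty (⋃ n, K n) := hne.to_subtype
  -- Restricting the supremum to a `σ`-compact set of full measure makes it Borel and keeps it
  -- Lipschitz, at the price of `u ≤ g` only almost everywhere.
  let g : X → ℝ := fun y => ⨆ x : ⋃ n, K n, (u x - d x y)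
  have hg : ∀ y, g y ≤ -v y := fun y => ciSup_le fun x => hle x y
  have hgL : ∀ y y', g y ≤ g y' + d y y' := fun y y' => ciSup_le fun x => by
    have h1 := le_ciSup (hb y') x
    have h2 : (d x y' : ℝ) ≤ d x y + d y y' := by exact_mod_cast hdist.triangle x y y'
    linarith
  have hL : IsOneLipschitz d g := fun y y' => by
    have h1 := hgL y y'
    have h2 := hgL y' y
    rw [hdist.symm y' y] at h2
    exact abs_sub_le_iff.2 ⟨by linarith, by linarith⟩
  have hA' : ∀ x, -max A B ≤ u x := fun x => by
    linarith [(abs_le.1 (hA x)).1, le_max_left A B]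
  have hB' : ∀ x, -max A B ≤ -v x := fun x => by
    linarith [(abs_le.1 (hB x)).2, le_max_right A B]
  -- The distance may be unbounded, so `g` is cut off from below, at a level that stays under both
  -- `u` and `-v`.
  refine ⟨fun y => max (g y) (-max A B), ⟨(measurable_iSup_sub hd huc hK hne hb).max
    measurable_const, max A B, fun y => abs_le.2 ⟨le_max_right _ _, ?_⟩⟩, fun y y' => ?_, ?_,
    fun y => max_le (hg y) (hB' y)⟩
  · refine (max_le (hg y) (hB' y)).trans ?_
    linarith [(abs_le.1 (hB y)).1, le_max_right A B]
  · exact (abs_max_sub_max_le_abs _ _ _).trans (hL y y')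
  · filter_upwards [hKμ] with x hx
    have h1 := le_ciSup (hb x) ⟨x, hx⟩
    simp only [(hdist.eq_zero_iff x x).2 rfl, NNReal.coe_zero, sub_zero] at h1
    exact h1.trans (le_max_left _ _)

end MetricCost

end TransportEntropy

end

/-! ### The three equivalences -/

theorem mainTheorem3 {X : Type*} [TopologicalSpace X] [PolishSpace X] [MeasurableSpace X]
    [BorelSpace X] (μ : Measure X) [IsProbabilityMeasure μ] (α : ℝ → ℝ)
    (hα : TransportEntropy.ClassA α) :
    -- the dual characterization
    (∀ c : X → X → ℝ≥0, TransportEntropy.LscCost c →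
      List.TFAE [
        TransportEntropy.TransportEntropyIneq α c μ,
        ∀ u ∈ TransportEntropy.Cb X, ∀ v ∈ TransportEntropy.Cb X,
          (∀ x y, u x + v y ≤ c x y) → TransportEntropy.ExpBound α μ u (-∫ y, v y ∂μ),
        ∀ u ∈ TransportEntropy.Bb X, ∀ v ∈ TransportEntropy.Bb X,
          (∀ x y, u x + v y ≤ c x y) → TransportEntropy.ExpBound α μ u (-∫ y, v y ∂μ)]) ∧
    -- the optimized forms
    (∀ c : X → X → ℝ≥0, TransportEntropy.LscCost c → (∀ x, c x x = 0) →
      (∀ f ∈ TransportEntropy.Bb X, Integrable (TransportEntropy.supConv c f) μ ∧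
        Integrable (TransportEntropy.infConv c f) μ) ∧
      List.TFAE [
        TransportEntropy.TransportEntropyIneq α c μ,
        ∀ f ∈ TransportEntropy.Cb X,
          TransportEntropy.ExpBound α μ f (∫ y, TransportEntropy.supConv c f y ∂μ),
        ∀ g ∈ TransportEntropy.Cb X,
          TransportEntropy.ExpBound α μ (TransportEntropy.infConv c g) (∫ y, g y ∂μ),
        ∀ f ∈ TransportEntropy.Bb X,
          TransportEntropy.ExpBound α μ f (∫ y, TransportEntropy.supConv c f y ∂μ),
        ∀ g ∈ TransportEntropy.Bb X,
          TransportEntropy.ExpBound α μ (TransportEntropy.infConv c g) (∫ y, g y ∂μ)]) ∧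
    -- metric costs
    (∀ d : X → X → ℝ≥0, TransportEntropy.LscCost d → TransportEntropy.IsDistance d →
      (TransportEntropy.TransportEntropyIneq α d μ → (∃ r : ℝ, 0 ≤ r ∧ α r ≠ 0) →
        ∀ f : X → ℝ, AEMeasurable f μ → TransportEntropy.IsOneLipschitz d f →
          Integrable f μ) ∧
      List.TFAE [
        TransportEntropy.TransportEntropyIneq α d μ,
        ∀ f : X → ℝ, Measurable f → Integrable f μ → TransportEntropy.IsOneLipschitz d f →
          TransportEntropy.ExpBound α μ f (∫ x, f x ∂μ),
        ∀ f : X → ℝ, Integrable f μ → TransportEntropy.IsOneLipschitz d f →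
          TransportEntropy.ExpBound α μ f (∫ x, f x ∂μ)]) := by
  open TransportEntropy in
  have : Nonempty X := nonempty_of_isProbabilityMeasure μ
  refine ⟨fun c hc => ?_, fun c hc hc0 => ?_, fun d hd hdist => ?_⟩
  · tfae_have 1 → 3 := fun h u hu v hv huv => h.expBound hα hu hv huv
    tfae_have 3 → 2 := fun h u hu v hv => h u (Cb_subset_Bb hu) v (Cb_subset_Bb hv)
    tfae_have 2 → 1 := transportEntropyIneq_of_expBound hα hc
    tfae_finish
  · have hint : ∀ f ∈ Bb X, Integrable (supConv c f) μ ∧ Integrable (infConv c f) μ := by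
      rintro f ⟨hm, K, hK⟩
      exact ⟨.of_bound (aemeasurable_supConv hc hm hK μ).aestronglyMeasurable K
          (ae_of_all _ (abs_supConv_le hc0 hK)),
        .of_bound (aemeasurable_infConv hc hm hK μ).aestronglyMeasurable K
          (ae_of_all _ (abs_infConv_le hc0 hK))⟩
    refine ⟨hint, ?_⟩
    tfae_have 1 → 4 := by
      rintro h f ⟨hm, K, hK⟩
      simpa [integral_neg] using h.expBound_of_aemeasurable hα hm.aemeasurable hK
        (aemeasurable_supConv hc hm hK μ).neg
        (fun x => (abs_neg _).trans_le (abs_supConv_le hc0 hK x)) (add_neg_supConv_le hK)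
    tfae_have 1 → 5 := by
      rintro h g ⟨hm, K, hK⟩
      simpa [integral_neg] using h.expBound_of_aemeasurable hα
        (aemeasurable_infConv hc hm hK μ) (abs_infConv_le hc0 hK) hm.neg.aemeasurable
        (fun x => (abs_neg _).trans_le (hK x)) (infConv_add_neg_le hK)
    tfae_have 4 → 2 := fun h f hf => h f (Cb_subset_Bb hf)
    tfae_have 5 → 3 := fun h g hg => h g (Cb_subset_Bb hg)
    -- Admissibility of `(u, v)` means `P_c u ≤ -v`, so the bound with `P_c u` is the stronger one.
    tfae_have 2 → 1 := fun h => transportEntropyIneq_of_expBound hα hc fun u hu v hv huv => by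
      refine (h u hu).mono (ae_of_all _ fun x => le_rfl) ?_
      rw [← integral_neg]
      refine integral_mono (hint u (Cb_subset_Bb hu)).1 (Bb.integrable (Cb_subset_Bb hv) μ).neg
        fun y => ciSup_le fun x => ?_
      linarith [huv x y]
    -- Here admissibility is read as `u ≤ Q_c (-v)`.
    tfae_have 3 → 1 := fun h => transportEntropyIneq_of_expBound hα hc fun u hu v hv huv => by
      have hv' : (fun y => -v y) ∈ Cb X := ⟨hv.1.neg, hv.2.imp fun K hK x => by simpa using hK x⟩
      refine (h _ hv').mono (ae_of_all _ fun x => le_ciInf fun y => ?_) (integral_neg _).le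
      linarith [huv x y]
    tfae_finish
  · refine ⟨fun h hne f hf hL => h.integrable_of_lipschitz hα hne hf hL, ?_⟩
    tfae_have 1 → 3 := fun h f hf hL => h.expBound_of_lipschitz hα hf hL
    tfae_have 3 → 2 := fun h f _ hf hL => h f hf hL
    tfae_have 2 → 1 := fun h => transportEntropyIneq_of_expBound hα hd fun u hu v hv huv => by
      obtain ⟨f, hf, hL, huf, hfv⟩ := exists_lipschitz_between μ hd hdist hu hv huv
      have hfi := Bb.integrable hf μ
      refine (h f hf.1 hfi hL).mono huf ?_
      rw [← integral_neg]
      exact integral_mono hfi (Bb.integrable (Cb_subset_Bb hv) μ).neg hfv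
    tfae_finish
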